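/- Let $n\ge 1$ be an integer. For $f:\mathbb Z^n\to\mathbb R\cup\{+\infty\}$ write $\operatorname{dom} f=\{x\in\mathbb Z^n\mid f(x)<+\infty\}$ (and likewise for functions of any number of integer variables), and for $S\subseteq\mathbb Z^n$ let $\delta_S$ be the function equal to $0$ on $S$ and to $+\infty$ on $\mathbb Z^n\setminus S$. Maxima, minima ($\vee,\wedge$) and roundings ($\lceil\cdot\rceil,\lfloor\cdot\rfloor$) of vectors are taken componentwise. Definitions. - A *box of integers* is a set of the form $\{x\in\mathbb Z^n\mid a_i\le x_i\le b_i\ (i=1,\dots,n)\}$ with $a\in(\mathbb Z\cup\{-\infty\})^n$, $b\in(\mathbb Z\cup\{+\infty\})^n$ and $a\le b$. - A function $f:\mathbb Z^n\to\mathbb R\cup\{+\infty\}$ is *separable convex* if $\operatorname{dom} f\ne\emptyset$ and $f(x)=\varphi_1(x_1)+\cdots+\varphi_n(x_n)$ for all $x\in\mathbb Z^n$, for some functions $\varphi_i:\mathbb Z\to\mathbb R\cup\{+\infty\}$ such that each $\operatorname{dom}\varphi_i$ is an interval of integers and $\varphi_i(t-1)+\varphi_i(t+1)\ge 2\varphi_i(t)$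 for all $t\in\mathbb Z$. - A function $f:\mathbb Z^n\to\mathbb R\cup\{+\infty\}$ is *multimodular* if $\operatorname{dom} f\neq\emptyset$ and the function $\tilde f(x_0,x_1,\dots,x_n)=f(x_1-x_0,x_2-x_1,\dots,x_n-x_{n-1})$ on $\mathbb Z^{n+1}$ is submodular, i.e. $\tilde f(u)+\tilde f(v)\ge\tilde f(u\vee v)+\tilde f(u\wedge v)$ for all $u,v\in\mathbb Z^{n+1}$. A set $S\subseteq\mathbb Z^n$ is *multimodular* if it is nonempty and $\delta_S$ is multimodular. - A function $f:\mathbb Z^n\to\mathbb R\cup\{+\infty\}$ is *L$^\natural$-convex* if $\operatorname{dom} f\neq\emptyset$ and $f(x)+f(y)\ge f\left(\left\lceil\frac{x+y}2\right\rceil\right)+f\left(\left\lfloor\frac{x+y}2\right\rfloor\right)$ for all $x,y\in\mathbb Z^n$. A set $S\subseteq\mathbb Z^n$ is *L$^\natural$-convex* if it is nonempty and $\left\lceil\frac{x+y}2\right\rceil,\left\lfloor\frac{x+y}2\right\rfloor\in S$ for all $x,y\in S$. Theorem. (1) A set $S\subseteq\mathbb Z^n$ is a box of integers if and only if it is both multimodular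 and L$^\natural$-convex. (2) A function $f:\mathbb Z^n\to\mathbb R\cup\{+\infty\}$ is separable convex if and only if it is both multimodular and L$^\natural$-convex. -/

import Mathlib

/-- The effective domain of `f : ℤⁿ → ℝ ∪ {+∞}`; the codomain is modelled by `WithTop ℝ`. -/
def effDom {α : Type*} (f : α → WithTop ℝ) : Set α := {x | f x < ⊤}

open Classical in
/-- The indicator function `δ_S`, equal to `0` on `S` and to `+∞` outside `S`. -/
noncomputable def indicatorFn {α : Type*} (S : Set α) : α → WithTop ℝ :=
  fun x => if x ∈ S then 0 else ⊤

/-- `S` is a box of integers `[a, b]_ℤ` with `a ∈ (ℤ ∪ {-∞})ⁿ`, `b ∈ (ℤ ∪ {+∞})ⁿ`, `a ≤ b`.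
The extended integers `ℤ ∪ {-∞, +∞}` are modelled by `WithBot (WithTop ℤ)`. -/
def IsIntBox {n : ℕ} (S : Set (Fin n → ℤ)) : Prop :=
  ∃ a b : Fin n → WithBot (WithTop ℤ),
    (∀ i, a i ≠ ⊤) ∧ (∀ i, b i ≠ ⊥) ∧ (∀ i, a i ≤ b i) ∧
    S = {x | ∀ i, a i ≤ ((x i : WithTop ℤ) : WithBot (WithTop ℤ)) ∧
      ((x i : WithTop ℤ) : WithBot (WithTop ℤ)) ≤ b i}

/-- A univariate discrete convex function `φ : ℤ → ℝ ∪ {+∞}`: its effective domain is an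
interval of integers and `φ(t-1) + φ(t+1) ≥ 2 φ(t)` for all `t`. -/
def UnivariateConvex (φ : ℤ → WithTop ℝ) : Prop :=
  (effDom φ).OrdConnected ∧ ∀ t : ℤ, φ (t - 1) + φ (t + 1) ≥ 2 • φ t

/-- Separable convexity (of a function with nonempty effective domain). -/
def SeparableConvex {n : ℕ} (f : (Fin n → ℤ) → WithTop ℝ) : Prop :=
  (effDom f).Nonempty ∧
    ∃ φ : Fin n → ℤ → WithTop ℝ,
      (∀ i, UnivariateConvex (φ i)) ∧ ∀ x, f x = ∑ i, φ i (x i)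

/-- Submodularity; `⊔` and `⊓` on `ι → ℤ` are the componentwise maximum and minimum. -/
def Submodular {ι : Type*} (f : (ι → ℤ) → WithTop ℝ) : Prop :=
  ∀ x y, f x + f y ≥ f (x ⊔ y) + f (x ⊓ y)

/-- The function `f̃(x₀, x₁, …, xₙ) = f(x₁ - x₀, x₂ - x₁, …, xₙ - xₙ₋₁)`. -/
def differenceLift {n : ℕ} (f : (Fin n → ℤ) → WithTop ℝ) : (Fin (n + 1) → ℤ) → WithTop ℝ :=
  fun z => f (fun i => z i.succ - z i.castSucc)

/-- Multimodular functions. -/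
def Multimodular {n : ℕ} (f : (Fin n → ℤ) → WithTop ℝ) : Prop :=
  (effDom f).Nonempty ∧ Submodular (differenceLift f)

/-- Multimodular sets: nonempty sets with multimodular indicator function. -/
def MultimodularSet {n : ℕ} (S : Set (Fin n → ℤ)) : Prop :=
  S.Nonempty ∧ Multimodular (indicatorFn S)

/-- The componentwise rounding-up of `(x + y) / 2`. -/
noncomputable def midCeil {n : ℕ} (x y : Fin n → ℤ) : Fin n → ℤ :=
  fun i => ⌈((x i : ℝ) + (y i : ℝ)) / 2⌉

/-- The componentwise rounding-down of `(x + y) / 2`. -/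
noncomputable def midFloor {n : ℕ} (x y : Fin n → ℤ) : Fin n → ℤ :=
  fun i => ⌊((x i : ℝ) + (y i : ℝ)) / 2⌋

/-- L♮-convex sets: nonempty sets with discrete midpoint convexity. -/
def LNatConvexSet {n : ℕ} (S : Set (Fin n → ℤ)) : Prop :=
  S.Nonempty ∧ ∀ x ∈ S, ∀ y ∈ S, midCeil x y ∈ S ∧ midFloor x y ∈ S

/-- L♮-convex functions: functions with nonempty effective domain satisfying the
discrete midpoint inequality. -/
def LNatConvex {n : ℕ} (f : (Fin n → ℤ) → WithTop ℝ) : Prop :=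
  (effDom f).Nonempty ∧ ∀ x y, f x + f y ≥ f (midCeil x y) + f (midFloor x y)

/-! Both classes are compared through two "splitting" properties.

Lifting `x ≤ y` to `ℤⁿ⁺¹` by partial sums, normalised to agree at an index `k`, multimodularity
says that cutting both vectors at `k` and exchanging the tails does not increase `f x + f y`
(`Multimodular.splice_le`). Two such cuts isolate a single coordinate, so a multimodular set
containing `x ≤ y` contains the vectors obtained by copying one coordinate of one to the other.
On the other side, taking the midpoint with `x` repeatedly, always rounded up or always rounded down,
shows that an L♮-convex set containing `x` and `y` contains `x + 1_P` and `x - 1_N`, where `P` and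
`N` are the sets of coordinates in which `y` is larger, resp. smaller, than `x`. Together, one can
walk from `x` to `y` by unit steps in any order of the coordinates without leaving the set
(`step_mem`), so the set contains the whole interval spanned by `x` and `y`, and is a box.

For functions, the effective domain is a box by the same argument. On a unit square in directions
`i ≠ j` the two properties give opposite inequalities, hence
`f x + f (x ± eᵢ ± eⱼ) = f (x ± eᵢ) + f (x ± eⱼ)` (`square_eq`). Induction on the `ℓ¹`-distance to
a base point `c` then expresses `f` through its restrictions to the axis-parallel lines through
`c`, and these restrictions are convex by the midpoint inequality. Conversely, a univariate convex
function decreases in total when two arguments are moved towards each other with fixed sum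
(`UnivariateConvex.add_le_add`), and both defining inequalities follow coordinatewise. -/

/-! ### Univariate convex functions -/

lemma slope_mono {r : ℕ → ℝ} {N : ℕ} (h : ∀ k, k + 2 ≤ N → 2 * r (k + 1) ≤ r k + r (k + 2))
    (m k : ℕ) (hk : m + k + 1 ≤ N) : r (m + 1) - r m ≤ r (m + k + 1) - r (m + k) := by
  induction k with
  | zero => simp
  | succ k ih =>
    have h1 := ih (by omega)
    have h2 := h (m + k) (by omega)
    have e1 : m + (k + 1) + 1 = m + k + 2 := by omega
    have e2 : m + (k + 1) = m + k + 1 := by omega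
    rw [e1, e2]
    linarith

lemma add_le_add_of_convex {r : ℕ → ℝ} {N : ℕ}
    (h : ∀ k, k + 2 ≤ N → 2 * r (k + 1) ≤ r k + r (k + 2))
    (k m : ℕ) (hk : k + m ≤ N) : r k + r m ≤ r 0 + r (k + m) := by
  induction k with
  | zero => simp
  | succ k ih =>
    have h1 := ih (by omega)
    have h2 := slope_mono h k m (by omega)
    have e1 : k + 1 + m = k + m + 1 := by omega
    rw [e1]
    linarith

lemma coe_untopD_of_mem_effDom {α : Type*} {f : α → WithTop ℝ} {x : α} (hx : x ∈ effDom f) :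
    (((f x).untopD 0 : ℝ) : WithTop ℝ) = f x := by
  have : f x ≠ ⊤ := ne_of_lt hx
  lift f x to ℝ using this with r
  rfl

lemma notMem_effDom {α : Type*} {f : α → WithTop ℝ} {x : α} : x ∉ effDom f ↔ f x = ⊤ := by
  simp [effDom]

/-- Moving two arguments towards each other with fixed sum does not increase the total value. -/
lemma UnivariateConvex.add_le_add {φ : ℤ → WithTop ℝ} (hφ : UnivariateConvex φ) {s t p q : ℤ}
    (hp : s ≤ p) (hq : s ≤ q) (h : p + q = s + t) : φ p + φ q ≤ φ s + φ t := by
  by_cases hs : s ∈ effDom φ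
  swap
  · rw [notMem_effDom.1 hs, top_add]; exact le_top
  by_cases ht : t ∈ effDom φ
  swap
  · rw [notMem_effDom.1 ht, add_top]; exact le_top
  have hmem : ∀ u, s ≤ u → u ≤ t → u ∈ effDom φ := fun u h1 h2 => hφ.1.out hs ht ⟨h1, h2⟩
  set r : ℤ → ℝ := fun u => (φ u).untopD 0
  have hval : ∀ u, s ≤ u → u ≤ t → φ u = ((r u : ℝ) : WithTop ℝ) := fun u h1 h2 =>
    (coe_untopD_of_mem_effDom (hmem u h1 h2)).symm
  obtain ⟨k, rfl⟩ := Int.le.dest hp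
  obtain ⟨m, rfl⟩ := Int.le.dest hq
  obtain rfl : t = s + ((k + m : ℕ) : ℤ) := by push_cast; omega
  have key := add_le_add_of_convex (r := fun j : ℕ => r (s + j)) (N := k + m) (by
    intro j hj
    have h1 := hφ.2 (s + j + 1)
    have e1 : s + (j : ℤ) + 1 - 1 = s + j := by ring
    have e2 : s + (j : ℤ) + 1 + 1 = s + ((j + 2 : ℕ) : ℤ) := by push_cast; ring
    have e3 : s + (j : ℤ) + 1 = s + ((j + 1 : ℕ) : ℤ) := by push_cast; ring
    rw [e1, e2, e3, two_nsmul, hval _ (by omega) (by omega), hval _ (by omega) (by omega),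
      hval _ (by omega) (by omega)] at h1
    have h2 : r (s + ((j + 1 : ℕ) : ℤ)) + r (s + ((j + 1 : ℕ) : ℤ))
        ≤ r (s + j) + r (s + ((j + 2 : ℕ) : ℤ)) := by exact_mod_cast h1
    show 2 * r (s + ((j + 1 : ℕ) : ℤ)) ≤ r (s + j) + r (s + ((j + 2 : ℕ) : ℤ))
    linarith) k m le_rfl
  rw [hval (s + k) (by omega) (by omega), hval (s + m) (by omega) (by omega),
    hval s (by omega) (by omega), hval (s + ((k + m : ℕ) : ℤ)) (by omega) (by omega)]
  simp only [Nat.cast_zero, add_zero] at key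
  exact_mod_cast key

/-! ### Separable convex functions are multimodular and L♮-convex -/

section Midpoint

variable {n : ℕ} (x y : Fin n → ℤ) (i : Fin n)

lemma midFloor_apply : midFloor x y i = (x i + y i) / 2 := by
  unfold midFloor
  rw [Int.floor_eq_iff]
  have h1 : 2 * ((x i + y i) / 2) ≤ x i + y i := by omega
  have h2 : x i + y i < 2 * ((x i + y i) / 2) + 2 := by omega
  have h1' : (2 : ℝ) * (((x i + y i) / 2 : ℤ) : ℝ) ≤ x i + y i := by exact_mod_cast h1
  have h2' : (x i + y i : ℝ) < 2 * (((x i + y i) / 2 : ℤ) : ℝ) + 2 := by exact_mod_cast h2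
  constructor <;> linarith

lemma midCeil_apply : midCeil x y i = (x i + y i + 1) / 2 := by
  unfold midCeil
  rw [Int.ceil_eq_iff]
  have h1 : 2 * ((x i + y i + 1) / 2) < x i + y i + 2 := by omega
  have h2 : x i + y i ≤ 2 * ((x i + y i + 1) / 2) := by omega
  have h1' : (2 : ℝ) * (((x i + y i + 1) / 2 : ℤ) : ℝ) < x i + y i + 2 := by exact_mod_cast h1
  have h2' : (x i + y i : ℝ) ≤ 2 * (((x i + y i + 1) / 2 : ℤ) : ℝ) := by exact_mod_cast h2
  constructor <;> linarith

end Midpoint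

theorem SeparableConvex.lNatConvex {n : ℕ} {f : (Fin n → ℤ) → WithTop ℝ}
    (hf : SeparableConvex f) : LNatConvex f := by
  obtain ⟨hne, φ, hφ, hsum⟩ := hf
  refine ⟨hne, fun x y => ?_⟩
  simp only [hsum, ge_iff_le, ← Finset.sum_add_distrib]
  refine Finset.sum_le_sum fun i _ => ?_
  rw [midCeil_apply, midFloor_apply]
  rcases le_total (x i) (y i) with h | h
  · exact (hφ i).add_le_add (by omega) (by omega) (by omega)
  · rw [add_comm (φ i (x i))]
    exact (hφ i).add_le_add (by omega) (by omega) (by omega)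

theorem SeparableConvex.multimodular {n : ℕ} {f : (Fin n → ℤ) → WithTop ℝ}
    (hf : SeparableConvex f) : Multimodular f := by
  obtain ⟨hne, φ, hφ, hsum⟩ := hf
  refine ⟨hne, fun x y => ?_⟩
  simp only [differenceLift, hsum, ge_iff_le, ← Finset.sum_add_distrib]
  refine Finset.sum_le_sum fun i _ => ?_
  simp only [Pi.sup_apply, Pi.inf_apply]
  rcases le_total (x i.succ - x i.castSucc) (y i.succ - y i.castSucc) with h | h
  · exact (hφ i).add_le_add (by omega) (by omega) (by omega)
  · rw [add_comm (φ i (x i.succ - x i.castSucc))]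
    exact (hφ i).add_le_add (by omega) (by omega) (by omega)

/-! ### Splitting inequality for multimodular functions -/

/-- The vector with the entries of `x` before position `k` and those of `y` from `k` on. -/
def splice {n : ℕ} (k : ℕ) (x y : Fin n → ℤ) : Fin n → ℤ :=
  fun j => if (j : ℕ) < k then x j else y j

/-- The partial sums of `x`, shifted by a constant so that they vanish at index `k`. -/
def anchoredSum {n : ℕ} (k : ℕ) (x : Fin n → ℤ) (m : ℕ) : ℤ :=
  ∑ j ∈ Finset.range m, (if h : j < n then x ⟨j, h⟩ else 0) -
    ∑ j ∈ Finset.range k, (if h : j < n then x ⟨j, h⟩ else 0)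

section Splice

variable {n : ℕ} {f : (Fin n → ℤ) → WithTop ℝ} {S : Set (Fin n → ℤ)} {x y : Fin n → ℤ}

lemma anchoredSum_succ_sub (k : ℕ) (x : Fin n → ℤ) (j : Fin n) :
    anchoredSum k x (j + 1) - anchoredSum k x j = x j := by
  simp [anchoredSum, Finset.sum_range_succ]

lemma anchoredSum_le_of_le {k m : ℕ} (h : x ≤ y) (hm : k ≤ m) :
    anchoredSum k x m ≤ anchoredSum k y m := by
  unfold anchoredSum
  rw [← Finset.sum_Ico_eq_sub _ hm, ← Finset.sum_Ico_eq_sub _ hm]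
  refine Finset.sum_le_sum fun j _ => ?_
  split_ifs
  · exact h _
  · exact le_rfl

lemma anchoredSum_le_of_ge {k m : ℕ} (h : x ≤ y) (hm : m ≤ k) :
    anchoredSum k y m ≤ anchoredSum k x m := by
  unfold anchoredSum
  rw [← neg_sub, ← Finset.sum_Ico_eq_sub _ hm, ← neg_sub (∑ j ∈ Finset.range k, _),
    ← Finset.sum_Ico_eq_sub _ hm, neg_le_neg_iff]
  refine Finset.sum_le_sum fun j _ => ?_
  split_ifs
  · exact h _
  · exact le_rfl

/-- Exchanging tails of comparable vectors does not increase a multimodular function: the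
anchored partial sums of `x` and `y` cross at `k`, so their maximum and minimum lift the two
spliced vectors. -/
theorem Multimodular.splice_le (hf : Multimodular f) (h : x ≤ y) (k : ℕ) :
    f (splice k x y) + f (splice k y x) ≤ f x + f y := by
  have key := hf.2 (fun m => anchoredSum k x m) (fun m => anchoredSum k y m)
  have hx : ∀ j : Fin n, _ := anchoredSum_succ_sub k x
  have hy : ∀ j : Fin n, _ := anchoredSum_succ_sub k y
  have h1 : (fun j : Fin n => anchoredSum k x j.succ - anchoredSum k x j.castSucc) = x :=
    funext fun j => by simpa using hx j
  have h2 : (fun j : Fin n => anchoredSum k y j.succ - anchoredSum k y j.castSucc) = y :=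
    funext fun j => by simpa using hy j
  have h3 : (fun j : Fin n => max (anchoredSum k x j.succ) (anchoredSum k y j.succ) -
      max (anchoredSum k x j.castSucc) (anchoredSum k y j.castSucc)) = splice k x y := by
    funext j
    simp only [splice, Fin.val_succ, Fin.val_castSucc]
    split_ifs with hj
    · rw [max_eq_left (anchoredSum_le_of_ge h hj), max_eq_left (anchoredSum_le_of_ge h hj.le), hx]
    · rw [not_lt] at hj
      rw [max_eq_right (anchoredSum_le_of_le h (by omega)),
        max_eq_right (anchoredSum_le_of_le h hj), hy]
  have h4 : (fun j : Fin n => min (anchoredSum k x j.succ) (anchoredSum k y j.succ) -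
      min (anchoredSum k x j.castSucc) (anchoredSum k y j.castSucc)) = splice k y x := by
    funext j
    simp only [splice, Fin.val_succ, Fin.val_castSucc]
    split_ifs with hj
    · rw [min_eq_right (anchoredSum_le_of_ge h hj), min_eq_right (anchoredSum_le_of_ge h hj.le), hy]
    · rw [not_lt] at hj
      rw [min_eq_left (anchoredSum_le_of_le h (by omega)),
        min_eq_left (anchoredSum_le_of_le h hj), hx]
  simpa only [differenceLift, Pi.sup_apply, Pi.inf_apply, h1, h2, h3, h4] using key

/-- Closure of a set under exchanging tails of comparable vectors. -/
def SpliceClosed (S : Set (Fin n → ℤ)) : Prop :=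
  ∀ x ∈ S, ∀ y ∈ S, x ≤ y → ∀ k, splice k x y ∈ S ∧ splice k y x ∈ S

lemma Multimodular.spliceClosed (hf : Multimodular f) : SpliceClosed (effDom f) := by
  intro x hx y hy h k
  have h1 := (hf.splice_le h k).trans_lt (WithTop.add_lt_top.2 ⟨hx, hy⟩)
  exact WithTop.add_lt_top.1 h1

lemma LNatConvex.lNatConvexSet (hf : LNatConvex f) : LNatConvexSet (effDom f) := by
  refine ⟨hf.1, fun x hx y hy => ?_⟩
  have h1 := (hf.2 x y).trans_lt (WithTop.add_lt_top.2 ⟨hx, hy⟩)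
  exact WithTop.add_lt_top.1 h1

lemma SpliceClosed.update_left_mem (hS : SpliceClosed S) (hx : x ∈ S) (hy : y ∈ S) (h : x ≤ y)
    (i : Fin n) : Function.update x i (y i) ∈ S := by
  have h1 := (hS x hx y hy h (i + 1)).2
  have hle : x ≤ splice (i + 1) y x := by
    intro j; unfold splice; split_ifs
    · exact h j
    · exact le_rfl
  convert (hS x hx _ h1 hle i).1 using 1
  funext j
  rcases lt_trichotomy (j : ℕ) i with hj | hj | hj
  · have : j ≠ i := by rintro rfl; omega
    simp [splice, this, hj]
  · obtain rfl := Fin.ext hj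
    simp [splice]
  · have : j ≠ i := by rintro rfl; omega
    simp [splice, this, show ¬ (j : ℕ) < i by omega, show ¬ (j : ℕ) < i + 1 by omega]

lemma SpliceClosed.update_right_mem (hS : SpliceClosed S) (hx : x ∈ S) (hy : y ∈ S) (h : x ≤ y)
    (i : Fin n) : Function.update y i (x i) ∈ S := by
  have h1 := (hS x hx y hy h (i + 1)).1
  have hle : splice (i + 1) x y ≤ y := by
    intro j; unfold splice; split_ifs
    · exact h j
    · exact le_rfl
  convert (hS _ h1 y hy hle i).2 using 1
  funext j
  rcases lt_trichotomy (j : ℕ) i with hj | hj | hj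
  · have : j ≠ i := by rintro rfl; omega
    simp [splice, this, hj]
  · obtain rfl := Fin.ext hj
    simp [splice]
  · have : j ≠ i := by rintro rfl; omega
    simp [splice, this, show ¬ (j : ℕ) < i by omega, show ¬ (j : ℕ) < i + 1 by omega]

/-! ### Unit steps inside a set that is both splice-closed and L♮-convex -/

/-- Repeated rounded-up midpoints with `x` end at `x + 1_P`, `P = {i | x i < y i}`. -/
lemma LNatConvexSet.add_indicator_mem (hS : LNatConvexSet S) (hx : x ∈ S) (hy : y ∈ S) :
    (fun i => x i + if x i < y i then 1 else 0) ∈ S := by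
  suffices H : ∀ (N : ℕ), ∀ y ∈ S, (∀ i, |y i - x i| ≤ N + 1) →
      (fun i => x i + if x i < y i then 1 else 0) ∈ S by
    refine H (∑ i, |y i - x i|).toNat y hy fun i => ?_
    have := Finset.single_le_sum (f := fun i => |y i - x i|) (fun i _ => abs_nonneg _)
      (Finset.mem_univ i)
    omega
  intro N
  induction N with
  | zero =>
    intro y hy hb
    convert (hS.2 x hx y hy).1 using 1
    funext i
    have := abs_le.1 (hb i)
    rw [midCeil_apply]
    split_ifs <;> push_cast at this <;> omega
  | succ N ih =>
    intro y hy hb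
    convert ih _ (hS.2 x hx y hy).1 (fun i => ?_) using 4 with i
    · rw [midCeil_apply]; omega
    · have := abs_le.1 (hb i)
      rw [midCeil_apply, abs_le]
      push_cast at this
      omega

/-- Repeated rounded-down midpoints with `x` end at `x - 1_N`, `N = {i | y i < x i}`. -/
lemma LNatConvexSet.sub_indicator_mem (hS : LNatConvexSet S) (hx : x ∈ S) (hy : y ∈ S) :
    (fun i => x i - if y i < x i then 1 else 0) ∈ S := by
  suffices H : ∀ (N : ℕ), ∀ y ∈ S, (∀ i, |y i - x i| ≤ N + 1) →
      (fun i => x i - if y i < x i then 1 else 0) ∈ S by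
    refine H (∑ i, |y i - x i|).toNat y hy fun i => ?_
    have := Finset.single_le_sum (f := fun i => |y i - x i|) (fun i _ => abs_nonneg _)
      (Finset.mem_univ i)
    omega
  intro N
  induction N with
  | zero =>
    intro y hy hb
    convert (hS.2 x hx y hy).2 using 1
    funext i
    have := abs_le.1 (hb i)
    rw [midFloor_apply]
    split_ifs <;> push_cast at this <;> omega
  | succ N ih =>
    intro y hy hb
    convert ih _ (hS.2 x hx y hy).2 (fun i => ?_) using 4 with i
    · rw [midFloor_apply]; omega
    · have := abs_le.1 (hb i)
      rw [midFloor_apply, abs_le]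
      push_cast at this
      omega

/-- From `x` one may move by one unit towards `y` in any single coordinate. -/
theorem step_mem (hsp : SpliceClosed S) (hL : LNatConvexSet S) (hx : x ∈ S) (hy : y ∈ S)
    (i : Fin n) : x + Pi.single i (y i - x i).sign ∈ S := by
  rcases lt_trichotomy (x i) (y i) with h | h | h
  · convert hsp.update_left_mem hx (hL.add_indicator_mem hx hy) ?_ i using 1
    · funext j
      by_cases hj : j = i
      · subst hj
        simp [h, Int.sign_eq_one_of_pos (sub_pos.2 h)]
      · simp [hj]
    · intro j
      simp only
      split_ifs <;> omega
  · simpa [h] using hx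
  · convert hsp.update_right_mem (hL.sub_indicator_mem hx hy) hx ?_ i using 1
    · funext j
      by_cases hj : j = i
      · subst hj
        simp [h, sub_eq_add_neg]
      · simp [hj]
    · intro j
      simp only
      split_ifs <;> omega

lemma sum_natAbs_step_lt {x z : Fin n → ℤ} {i : Fin n} (h : x i ≠ z i) :
    ∑ j, (z j - (x + Pi.single i (z i - x i).sign : Fin n → ℤ) j).natAbs <
      ∑ j, (z j - x j).natAbs := by
  have hi : (z i - (x i + (z i - x i).sign)).natAbs < (z i - x i).natAbs := by
    rcases lt_or_gt_of_ne h with h | h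
    · rw [Int.sign_eq_one_of_pos (sub_pos.2 h)]; omega
    · rw [Int.sign_eq_neg_one_of_neg (sub_neg.2 h)]; omega
  refine Finset.sum_lt_sum (fun j _ => ?_) ⟨i, Finset.mem_univ i, by simpa using hi⟩
  by_cases hj : j = i
  · subst hj
    simpa using hi.le
  · simp [hj]

theorem mem_of_mem_uIcc (hsp : SpliceClosed S) (hL : LNatConvexSet S) (hy : y ∈ S)
    {z : Fin n → ℤ} (hx : x ∈ S) (hz : ∀ i, z i ∈ Set.uIcc (x i) (y i)) : z ∈ S := by
  induction hN : ∑ j, (z j - x j).natAbs using Nat.strong_induction_on generalizing x with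
  | _ N ih =>
    by_cases hxz : x = z
    · exact hxz ▸ hx
    obtain ⟨i, hi⟩ := Function.ne_iff.1 hxz
    have hzi := Set.mem_uIcc.1 (hz i)
    have hsign : (z i - x i).sign = (y i - x i).sign := by
      rcases lt_or_gt_of_ne hi with h | h
      · rw [Int.sign_eq_one_of_pos (by omega), Int.sign_eq_one_of_pos (by omega)]
      · rw [Int.sign_eq_neg_one_of_neg (by omega), Int.sign_eq_neg_one_of_neg (by omega)]
    refine ih _ (hN ▸ sum_natAbs_step_lt hi) (hsign ▸ step_mem hsp hL hx hy i) (fun j => ?_) rfl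
    by_cases hj : j = i
    · subst hj
      rw [Set.mem_uIcc]
      simp only [Pi.add_apply, Pi.single_eq_same]
      rcases lt_or_gt_of_ne hi with h | h
      · rw [Int.sign_eq_one_of_pos (by omega)]; omega
      · rw [Int.sign_eq_neg_one_of_neg (by omega)]; omega
    · simpa [hj] using hz j

lemma update_mem (hsp : SpliceClosed S) (hL : LNatConvexSet S) (hx : x ∈ S) (hy : y ∈ S)
    {i : Fin n} {t : ℤ} (ht : t ∈ Set.uIcc (x i) (y i)) : Function.update x i t ∈ S := by
  refine mem_of_mem_uIcc hsp hL hy hx fun j => ?_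
  by_cases hj : j = i
  · subst hj; simpa using ht
  · simp [hj]

/-- Such a set is the product of its coordinate projections. -/
lemma mem_of_forall_exists (hsp : SpliceClosed S) (hL : LNatConvexSet S)
    (h : ∀ i, ∃ y ∈ S, y i = x i) : x ∈ S := by
  have H : ∀ F : Finset (Fin n), ∃ z ∈ S, ∀ i ∈ F, z i = x i := by
    intro F
    induction F using Finset.induction_on with
    | empty => exact ⟨_, hL.1.some_mem, by simp⟩
    | insert i F _ ih =>
      obtain ⟨z, hz, hzF⟩ := ih
      obtain ⟨y, hy, hyi⟩ := h i
      refine ⟨_, update_mem hsp hL hz hy (i := i) (t := x i) (hyi ▸ Set.right_mem_uIcc), ?_⟩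
      intro j hj
      by_cases hji : j = i
      · subst hji; simp
      · rw [Function.update_of_ne hji]
        exact hzF j (Finset.mem_of_mem_insert_of_ne hj hji)
  obtain ⟨z, hz, hzx⟩ := H Finset.univ
  rwa [show x = z from funext fun i => (hzx i (Finset.mem_univ i)).symm]

end Splice

/-! ### Boxes of integers -/

lemma exists_extended_bounds {T : Set ℤ} (hne : T.Nonempty) (hT : T.OrdConnected) :
    ∃ a b : WithBot (WithTop ℤ), a ≠ ⊤ ∧ b ≠ ⊥ ∧ a ≤ b ∧
      ∀ t : ℤ, t ∈ T ↔ a ≤ ((t : WithTop ℤ) : WithBot (WithTop ℤ)) ∧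
        ((t : WithTop ℤ) : WithBot (WithTop ℤ)) ≤ b := by
  obtain ⟨u, hu⟩ := hne
  have hlow : ∃ a : WithBot (WithTop ℤ), a ≠ ⊤ ∧
      ∀ t : ℤ, (∃ s ∈ T, s ≤ t) ↔ a ≤ ((t : WithTop ℤ) : WithBot (WithTop ℤ)) := by
    by_cases hb : BddBelow T
    · refine ⟨((sInf T : ℤ) : WithTop ℤ), ?_, fun t => ?_⟩
      · exact fun h => WithTop.coe_ne_top (WithBot.coe_injective h)
      · rw [WithBot.coe_le_coe, WithTop.coe_le_coe]
        exact ⟨fun ⟨s, hs, hst⟩ => (csInf_le hb hs).trans hst,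
          fun h => ⟨_, Int.csInf_mem ⟨u, hu⟩ hb, h⟩⟩
    · refine ⟨⊥, bot_ne_top, fun t => ⟨fun _ => bot_le, fun _ => ?_⟩⟩
      obtain ⟨s, hs, hst⟩ := not_bddBelow_iff.1 hb t
      exact ⟨s, hs, hst.le⟩
  have hupp : ∃ b : WithBot (WithTop ℤ), b ≠ ⊥ ∧
      ∀ t : ℤ, (∃ s ∈ T, t ≤ s) ↔ ((t : WithTop ℤ) : WithBot (WithTop ℤ)) ≤ b := by
    by_cases hb : BddAbove T
    · refine ⟨((sSup T : ℤ) : WithTop ℤ), WithBot.coe_ne_bot, fun t => ?_⟩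
      rw [WithBot.coe_le_coe, WithTop.coe_le_coe]
      exact ⟨fun ⟨s, hs, hst⟩ => hst.trans (le_csSup hb hs),
        fun h => ⟨_, Int.csSup_mem ⟨u, hu⟩ hb, h⟩⟩
    · refine ⟨⊤, top_ne_bot, fun t => ⟨fun _ => le_top, fun _ => ?_⟩⟩
      obtain ⟨s, hs, hst⟩ := not_bddAbove_iff.1 hb t
      exact ⟨s, hs, hst.le⟩
  obtain ⟨a, ha, ha'⟩ := hlow
  obtain ⟨b, hb, hb'⟩ := hupp
  refine ⟨a, b, ha, hb, ((ha' u).1 ⟨u, hu, le_rfl⟩).trans ((hb' u).1 ⟨u, hu, le_rfl⟩), fun t => ?_⟩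
  rw [← ha', ← hb']
  exact ⟨fun h => ⟨⟨t, h, le_rfl⟩, ⟨t, h, le_rfl⟩⟩,
    fun ⟨⟨s, hs, h1⟩, ⟨s', hs', h2⟩⟩ => hT.out hs hs' ⟨h1, h2⟩⟩

lemma exists_int_mem_of_le {a b : WithBot (WithTop ℤ)} (ha : a ≠ ⊤) (hb : b ≠ ⊥) (hab : a ≤ b) :
    ∃ t : ℤ, a ≤ ((t : WithTop ℤ) : WithBot (WithTop ℤ)) ∧
      ((t : WithTop ℤ) : WithBot (WithTop ℤ)) ≤ b := by
  induction a using WithBot.recBotCoe with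
  | bot =>
    induction b using WithBot.recBotCoe with
    | bot => exact absurd rfl hb
    | coe b =>
      induction b using WithTop.recTopCoe with
      | top => exact ⟨0, bot_le, le_top⟩
      | coe b => exact ⟨b, bot_le, le_rfl⟩
  | coe a =>
    induction a using WithTop.recTopCoe with
    | top => exact absurd rfl ha
    | coe a => exact ⟨a, le_rfl, hab⟩

lemma effDom_indicatorFn {α : Type*} (S : Set α) : effDom (indicatorFn S) = S := by
  ext x
  by_cases h : x ∈ S <;> simp [effDom, indicatorFn, h]

lemma univariateConvex_indicatorFn {T : Set ℤ} (hT : T.OrdConnected) :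
    UnivariateConvex (indicatorFn T) := by
  refine ⟨by rwa [effDom_indicatorFn], fun t => ?_⟩
  by_cases h1 : t - 1 ∈ T
  · by_cases h2 : t + 1 ∈ T
    · have : t ∈ T := hT.out h1 h2 ⟨by omega, by omega⟩
      simp [indicatorFn, h1, h2, this]
    · simp [indicatorFn, h2]
  · simp [indicatorFn, h1]

theorem IsIntBox.separableConvex_indicatorFn {n : ℕ} {S : Set (Fin n → ℤ)} (hS : IsIntBox S) :
    SeparableConvex (indicatorFn S) := by
  obtain ⟨a, b, ha, hb, hab, rfl⟩ := hS
  set T : Fin n → Set ℤ := fun i => {t : ℤ | a i ≤ ((t : WithTop ℤ) : WithBot (WithTop ℤ)) ∧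
      ((t : WithTop ℤ) : WithBot (WithTop ℤ)) ≤ b i}
  have hmono : ∀ s t : ℤ, s ≤ t →
      ((s : WithTop ℤ) : WithBot (WithTop ℤ)) ≤ ((t : WithTop ℤ) : WithBot (WithTop ℤ)) := by
    intro s t h
    rwa [WithBot.coe_le_coe, WithTop.coe_le_coe]
  refine ⟨?_, fun i => indicatorFn (T i), fun i => univariateConvex_indicatorFn ⟨?_⟩, fun x => ?_⟩
  · rw [effDom_indicatorFn]
    choose t ht using fun i => exists_int_mem_of_le (ha i) (hb i) (hab i)
    exact ⟨t, ht⟩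
  · intro s hs t ht u hu
    exact ⟨hs.1.trans (hmono _ _ hu.1), (hmono _ _ hu.2).trans ht.2⟩
  · change indicatorFn {x : Fin n → ℤ | ∀ i, x i ∈ T i} x = _
    by_cases hx : ∀ i, x i ∈ T i
    · simp [indicatorFn, hx]
    · obtain ⟨i, hi⟩ := not_forall.1 hx
      have : ∑ i, indicatorFn (T i) (x i) = ⊤ :=
        WithTop.sum_eq_top.2 ⟨i, Finset.mem_univ i, by simp [indicatorFn, hi]⟩
      rw [this]
      exact if_neg hx

theorem isIntBox_of_spliceClosed {n : ℕ} {S : Set (Fin n → ℤ)} (hsp : SpliceClosed S)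
    (hL : LNatConvexSet S) : IsIntBox S := by
  have hproj : ∀ i : Fin n, ((fun x : Fin n → ℤ => x i) '' S).OrdConnected := by
    intro i
    refine ⟨?_⟩
    rintro _ ⟨x, hx, rfl⟩ _ ⟨y, hy, rfl⟩ t ht
    exact ⟨_, update_mem hsp hL hx hy (i := i) (Set.Icc_subset_uIcc ht), by simp⟩
  choose a b ha hb hab hT using fun i => exists_extended_bounds (hL.1.image _) (hproj i)
  refine ⟨a, b, ha, hb, hab, ?_⟩
  ext x
  simp only [Set.mem_ofPred_eq, ← hT]
  exact ⟨fun h i => ⟨x, h, rfl⟩, fun h => mem_of_forall_exists hsp hL h⟩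

/-! ### Multimodular L♮-convex functions are separable -/

section Square

variable {n : ℕ} {f : (Fin n → ℤ) → WithTop ℝ}

lemma square_eq_of_pos (hM : Multimodular f) (hL : LNatConvex f) (x : Fin n → ℤ) {i j : Fin n}
    (hij : i ≠ j) :
    f x + f (x + Pi.single i 1 + Pi.single j 1) =
      f (x + Pi.single i 1) + f (x + Pi.single j 1) := by
  wlog h : i < j generalizing i j
  · rw [add_right_comm, this hij.symm (lt_of_le_of_ne (not_lt.1 h) hij.symm), add_comm]
  apply le_antisymm
  · have h1 := hL.2 (x + Pi.single i 1) (x + Pi.single j 1)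
    have e1 : midCeil (x + Pi.single i 1) (x + Pi.single j 1) =
        x + Pi.single i 1 + Pi.single j 1 := by
      funext k
      rw [midCeil_apply]
      simp only [Pi.add_apply, Pi.single_apply]
      split_ifs <;> omega
    have e2 : midFloor (x + Pi.single i 1) (x + Pi.single j 1) = x := by
      funext k
      rw [midFloor_apply]
      simp only [Pi.add_apply, Pi.single_apply]
      split_ifs <;> omega
    rwa [e1, e2, add_comm (f (x + Pi.single i 1 + Pi.single j 1))] at h1
  · have hle : x ≤ x + Pi.single i 1 + Pi.single j 1 := by
      intro k
      simp only [Pi.add_apply, Pi.single_apply]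
      split_ifs <;> omega
    have h1 := hM.splice_le hle j
    have e1 : splice j x (x + Pi.single i 1 + Pi.single j 1) = x + Pi.single j 1 := by
      funext k
      simp only [splice, Pi.add_apply, Pi.single_apply]
      split_ifs <;> omega
    have e2 : splice j (x + Pi.single i 1 + Pi.single j 1) x = x + Pi.single i 1 := by
      funext k
      simp only [splice, Pi.add_apply, Pi.single_apply]
      split_ifs <;> omega
    rwa [e1, e2, add_comm (f (x + Pi.single j 1))] at h1

/-- The square identity with arbitrary signs: change the corner taken as base point. -/
lemma square_eq (hM : Multimodular f) (hL : LNatConvex f) (x : Fin n → ℤ) {i j : Fin n}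
    (hij : i ≠ j) {s t : ℤ} (hs : s = 1 ∨ s = -1) (ht : t = 1 ∨ t = -1) :
    f x + f (x + Pi.single i s + Pi.single j t) =
      f (x + Pi.single i s) + f (x + Pi.single j t) := by
  have ei : (Pi.single i (-1) : Fin n → ℤ) = -Pi.single i 1 := by rw [Pi.single_neg]
  have ej : (Pi.single j (-1) : Fin n → ℤ) = -Pi.single j 1 := by rw [Pi.single_neg]
  set u : Fin n → ℤ := Pi.single i 1
  set v : Fin n → ℤ := Pi.single j 1
  rcases hs with rfl | rfl <;> rcases ht with rfl | rfl
  · exact square_eq_of_pos hM hL x hij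
  · have h := square_eq_of_pos hM hL (x - v) hij
    rw [ej]
    rw [show x - v + u + v = x + u by abel, show x - v + u = x + u + -v by abel,
      show x - v + v = x by abel, show x - v = x + -v by abel] at h
    rw [add_comm (f x), ← h, add_comm]
  · have h := square_eq_of_pos hM hL (x - u) hij
    rw [ei]
    rw [show x - u + u + v = x + v by abel, show x - u + v = x + -u + v by abel,
      show x - u + u = x by abel, show x - u = x + -u by abel] at h
    exact h.symm
  · have h := square_eq_of_pos hM hL (x - u - v) hij
    rw [ei, ej]
    rw [show x - u - v + u + v = x by abel, show x - u - v + u = x + -v by abel,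
      show x - u - v + v = x + -u by abel, show x - u - v = x + -u + -v by abel] at h
    rw [add_comm (f x), h, add_comm]

/-- On its effective domain, `f` is determined by its restrictions to the axis-parallel lines
through `c`. -/
lemma untopD_eq_sum (hn : 1 ≤ n) (hM : Multimodular f) (hL : LNatConvex f) {c : Fin n → ℤ}
    (hc : c ∈ effDom f) (x : Fin n → ℤ) (hx : x ∈ effDom f) :
    (f x).untopD 0 = (f c).untopD 0 +
      ∑ i, ((f (Function.update c i (x i))).untopD 0 - (f c).untopD 0) := by
  have hsp := hM.spliceClosed
  have hLS := hL.lNatConvexSet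
  induction hN : ∑ j, (c j - x j).natAbs using Nat.strong_induction_on generalizing x with
  | _ N ih =>
    by_cases h2 : ∃ i j, i ≠ j ∧ x i ≠ c i ∧ x j ≠ c j
    · obtain ⟨i, j, hij, hi, hj⟩ := h2
      set s := (c i - x i).sign
      set t := (c j - x j).sign
      have hs' : s = 1 ∨ s = -1 := by
        rcases lt_or_gt_of_ne hi with h | h
        · exact Or.inl (Int.sign_eq_one_of_pos (by omega))
        · exact Or.inr (Int.sign_eq_neg_one_of_neg (by omega))
      have ht' : t = 1 ∨ t = -1 := by
        rcases lt_or_gt_of_ne hj with h | h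
        · exact Or.inl (Int.sign_eq_one_of_pos (by omega))
        · exact Or.inr (Int.sign_eq_neg_one_of_neg (by omega))
      have hxi : (x + Pi.single i s : Fin n → ℤ) j = x j := by simp [hij.symm]
      have hi_mem : x + Pi.single i s ∈ effDom f := step_mem hsp hLS hx hc i
      have hj_mem : x + Pi.single j t ∈ effDom f := step_mem hsp hLS hx hc j
      have hij_mem : x + Pi.single i s + Pi.single j t ∈ effDom f := by
        have := step_mem hsp hLS hi_mem hc j
        rwa [hxi] at this
      have hi_lt : ∑ k, (c k - (x + Pi.single i s : Fin n → ℤ) k).natAbs < N :=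
        hN ▸ sum_natAbs_step_lt hi
      have hj_lt : ∑ k, (c k - (x + Pi.single j t : Fin n → ℤ) k).natAbs < N :=
        hN ▸ sum_natAbs_step_lt hj
      have hij_lt : ∑ k, (c k - (x + Pi.single i s + Pi.single j t : Fin n → ℤ) k).natAbs < N := by
        have := sum_natAbs_step_lt (x := x + Pi.single i s) (z := c) (i := j) (by rwa [hxi])
        rw [hxi] at this
        exact this.trans hi_lt
      have h1 := ih _ hi_lt _ hi_mem rfl
      have h2 := ih _ hj_lt _ hj_mem rfl
      have h3 := ih _ hij_lt _ hij_mem rfl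
      have hsq := square_eq hM hL x hij hs' ht'
      rw [← coe_untopD_of_mem_effDom hx, ← coe_untopD_of_mem_effDom hi_mem,
        ← coe_untopD_of_mem_effDom hj_mem, ← coe_untopD_of_mem_effDom hij_mem] at hsq
      have hsq' : (f x).untopD 0 + (f (x + Pi.single i s + Pi.single j t)).untopD 0 =
          (f (x + Pi.single i s)).untopD 0 + (f (x + Pi.single j t)).untopD 0 := by
        exact_mod_cast hsq
      -- The separable right-hand side satisfies the same square identity, term by term.
      have hsum : ∀ g : Fin n → ℤ → ℝ,
          ∑ k, g k (x k) + ∑ k, g k ((x + Pi.single i s + Pi.single j t : Fin n → ℤ) k) =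
          ∑ k, g k ((x + Pi.single i s : Fin n → ℤ) k) +
            ∑ k, g k ((x + Pi.single j t : Fin n → ℤ) k) := by
        intro g
        rw [← Finset.sum_add_distrib, ← Finset.sum_add_distrib]
        refine Finset.sum_congr rfl fun k _ => ?_
        by_cases hki : k = i
        · subst hki
          simp [hij, add_comm]
        · simp [hki]
      have := hsum fun k t => (f (Function.update c k t)).untopD 0 - (f c).untopD 0
      linarith
    · obtain ⟨i, hi⟩ : ∃ i, ∀ k, k ≠ i → x k = c k := by
        by_cases h1 : ∃ i, x i ≠ c i
        · obtain ⟨i, hi⟩ := h1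
          exact ⟨i, fun k hk => by_contra fun h => h2 ⟨k, i, hk, h, hi⟩⟩
        · exact ⟨⟨0, hn⟩, fun k _ => by_contra fun h => h1 ⟨k, h⟩⟩
      have hxu : Function.update c i (x i) = x := by
        funext k
        by_cases hk : k = i
        · subst hk; simp
        · simp [hk, hi k hk]
      rw [Finset.sum_eq_single i]
      · rw [hxu]; ring
      · intro k _ hk
        simp [hi k hk]
      · simp

theorem separableConvex_of_multimodular_of_lNatConvex (hn : 1 ≤ n) (hM : Multimodular f)
    (hL : LNatConvex f) : SeparableConvex f := by
  have hsp := hM.spliceClosed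
  have hLS := hL.lNatConvexSet
  obtain ⟨c, hc⟩ := hM.1
  -- The constant spreads the value at `c` evenly over the `n` summands.
  set C : ℝ := (f c).untopD 0 / n - (f c).untopD 0 with hC
  refine ⟨hM.1, fun i t => f (Function.update c i t) + (C : WithTop ℝ), fun i => ⟨⟨?_⟩, ?_⟩, ?_⟩
  · intro s hs t ht u hu
    have hs' : Function.update c i s ∈ effDom f := (WithTop.add_lt_top.1 hs).1
    have ht' : Function.update c i t ∈ effDom f := (WithTop.add_lt_top.1 ht).1
    have := update_mem hsp hLS hs' ht' (i := i) (t := u)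
      (by simpa using Set.Icc_subset_uIcc hu)
    rw [Function.update_idem] at this
    exact WithTop.add_lt_top.2 ⟨this, WithTop.coe_lt_top C⟩
  · intro t
    have h1 := hL.2 (Function.update c i (t - 1)) (Function.update c i (t + 1))
    have e1 : midCeil (Function.update c i (t - 1)) (Function.update c i (t + 1)) =
        Function.update c i t := by
      funext k
      rw [midCeil_apply]
      by_cases hk : k = i
      · subst hk; simp only [Function.update_self]; omega
      · simp only [Function.update_of_ne hk]; omega
    have e2 : midFloor (Function.update c i (t - 1)) (Function.update c i (t + 1)) =
        Function.update c i t := by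
      funext k
      rw [midFloor_apply]
      by_cases hk : k = i
      · subst hk; simp only [Function.update_self]; omega
      · simp only [Function.update_of_ne hk]; omega
    rw [e1, e2] at h1
    simp only [ge_iff_le, two_nsmul]
    rw [add_add_add_comm, add_add_add_comm (f (Function.update c i (t - 1)))]
    gcongr
  · intro x
    by_cases hx : x ∈ effDom f
    · have hmem : ∀ i, Function.update c i (x i) ∈ effDom f := fun i =>
        update_mem hsp hLS hc hx Set.right_mem_uIcc
      have h1 := untopD_eq_sum hn hM hL hc x hx
      have h2 : ∀ i, f (Function.update c i (x i)) + (C : WithTop ℝ) =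
          (((f (Function.update c i (x i))).untopD 0 + C : ℝ) : WithTop ℝ) := by
        intro i
        rw [WithTop.coe_add, coe_untopD_of_mem_effDom (hmem i)]
      simp only [h2]
      rw [← coe_untopD_of_mem_effDom hx, ← WithTop.coe_sum, h1]
      congr 1
      have hn0 : (n : ℝ) ≠ 0 := by
        have : n ≠ 0 := by omega
        exact_mod_cast this
      simp only [Finset.sum_add_distrib, Finset.sum_sub_distrib, Finset.sum_const,
        Finset.card_univ, Fintype.card_fin, nsmul_eq_mul, hC]
      field_simp
      ring
    · have : ∃ i, Function.update c i (x i) ∉ effDom f := by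
        by_contra! h
        exact hx (mem_of_forall_exists hsp hLS fun i => ⟨_, h i, by simp⟩)
      obtain ⟨i, hi⟩ := this
      rw [notMem_effDom.1 hx, eq_comm]
      exact WithTop.sum_eq_top.2 ⟨i, Finset.mem_univ i, by
        simp only [notMem_effDom.1 hi, top_add]⟩

end Square

theorem theorem5p5 (n : ℕ) (hn : 1 ≤ n) :
    (∀ S : Set (Fin n → ℤ), IsIntBox S ↔ MultimodularSet S ∧ LNatConvexSet S) ∧
    (∀ f : (Fin n → ℤ) → WithTop ℝ, SeparableConvex f ↔ Multimodular f ∧ LNatConvex f) := by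
  refine ⟨fun S => ⟨fun hS => ?_, fun ⟨hM, hL⟩ => ?_⟩, fun f => ⟨fun hf => ?_, fun ⟨hM, hL⟩ => ?_⟩⟩
  · have hsep := hS.separableConvex_indicatorFn
    have hL := hsep.lNatConvex.lNatConvexSet
    rw [effDom_indicatorFn] at hL
    exact ⟨⟨hL.1, hsep.multimodular⟩, hL⟩
  · have hsp := hM.2.spliceClosed
    rw [effDom_indicatorFn] at hsp
    exact isIntBox_of_spliceClosed hsp hL
  · exact ⟨hf.multimodular, hf.lNatConvex⟩
  · exact separableConvex_of_multimodular_of_lNatConvex hn hM hL
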